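/- Let $\Omega$ be a finite set of $n$ states, $A$ a nonempty compact metric space of actions, $u_S:A\to\mathbb{R}$ and $u_R:\Omega\times A\to\mathbb{R}$ continuous utility functions of a sender and a receiver, and $p\in\Delta(\Omega)\subset\mathbb{R}^n$ a full-support common prior. For $\mu\in\Delta(\Omega)$ let $$\mathbf{V}(\mu)=\operatorname{co}\Big(u_S\big(\operatorname{argmax}_{a\in A}\textstyle\sum_{\omega}\mu(\omega)u_R(\omega,a)\big)\Big),$$ and write $V\in\mathbf{V}$ if $V:\Delta(\Omega)\to\mathbb{R}$ is a Borel measurable function with $V(\mu)\in\mathbf{V}(\mu)$ for all $\mu\in\Delta(\Omega)$. The mediation problem is $$\mathcal{V}_{MD}(p)=\sup_{V\in\mathbf{V},\ \tau\in\Delta(\Delta(\Omega))}\int V\,d\tau\quad\text{subject to}\quad \int\mu\,d\tau(\mu)=p,\qquad \int V(\mu)(\mu-p)\,d\tau(\mu)=\mathbf{0}.$$ A communication mechanism is a map $\sigma:R\to\Delta(M)$ from reports to distributions over messages; the sender observes $\omega\sim p$ and sends a (possibly random) report $r$, a message $m$ is drawn from $\sigma(r)$, and the receiver, who observes only $m$,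 takes a (possibly random) action. The mechanism implements $(V,\tau)$ if this game has a Bayes--Nash equilibrium in which $\tau$ is the distribution of the receiver's posterior belief after the message and in which, after every message of positive probability, the sender's expected utility equals $V$ evaluated at the receiver's posterior. Then the mediation problem has a solution $(V^*,\tau^*)$ that is implemented by a communication mechanism with at most $2n-1$ messages. Moreover, $$\mathcal{V}_{MD}(p)=\max_{V\in\mathbf{V}}\ \inf_{g\in\mathbb{R}^n}\ \operatorname{cav}(V^g)(p),\qquad V^g(\mu)=(1+\langle g,\mu-p\rangle)V(\mu),$$ where the maximum is attained and, for a bounded function $U:\Delta(\Omega)\to\mathbb{R}$, $\operatorname{cav}(U)$ is the pointwise infimum of all concave functions on $\Delta(\Omega)$ that majorize $U$. -/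

import Mathlib

open MeasureTheory

noncomputable section

namespace Mediation

/-- The set of maximizers over the action space of the receiver's expected utility at belief `μ`. -/
def bestResponses {Ω A : Type*} [Fintype Ω] (uR : Ω → A → ℝ) (μ : stdSimplex ℝ Ω) : Set A :=
  {a | ∀ a' : A, ∑ ω, μ ω * uR ω a' ≤ ∑ ω, μ ω * uR ω a}

/-- The indirect value correspondence: the convex hull of the sender's utilities of the receiver's
best responses at belief `μ`. -/
def valueCorr {Ω A : Type*} [Fintype Ω] (uS : A → ℝ) (uR : Ω → A → ℝ)
    (μ : stdSimplex ℝ Ω) : Set ℝ :=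
  convexHull ℝ (uS '' bestResponses uR μ)

/-- `V` is a (Borel) measurable selection of the indirect value correspondence. -/
structure IsMeasurableSelection {Ω A : Type*} [Fintype Ω] (uS : A → ℝ) (uR : Ω → A → ℝ)
    (V : stdSimplex ℝ Ω → ℝ) : Prop where
  measurable : Measurable V
  mem : ∀ μ, V μ ∈ valueCorr uS uR μ

/-- Feasibility in the mediation problem: `V` is a measurable selection and `τ` is a probability
distribution over beliefs satisfying Bayes plausibility and the truth-telling constraint, both
written state by state. -/
structure IsFeasible {Ω A : Type*} [Fintype Ω] (uS : A → ℝ) (uR : Ω → A → ℝ)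
    (p : stdSimplex ℝ Ω) (V : stdSimplex ℝ Ω → ℝ) (τ : Measure (stdSimplex ℝ Ω)) : Prop where
  selection : IsMeasurableSelection uS uR V
  isProbability : IsProbabilityMeasure τ
  bayesPlausible : ∀ ω, ∫ μ, μ ω ∂τ = p ω
  truthTelling : ∀ ω, ∫ μ, V μ * (μ ω - p ω) ∂τ = 0

/-- `(V, τ)` solves the mediation problem: it is feasible and its payoff is maximal among the
payoffs of all feasible pairs. -/
structure IsSolution {Ω A : Type*} [Fintype Ω] (uS : A → ℝ) (uR : Ω → A → ℝ)
    (p : stdSimplex ℝ Ω) (V : stdSimplex ℝ Ω → ℝ) (τ : Measure (stdSimplex ℝ Ω)) : Prop where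
  feasible : IsFeasible uS uR p V τ
  optimal : ∀ (V' : stdSimplex ℝ Ω → ℝ) (τ' : Measure (stdSimplex ℝ Ω)),
    IsFeasible uS uR p V' τ' → ∫ μ, V' μ ∂τ' ≤ ∫ μ, V μ ∂τ

/-- The optimal value of mediation at prior `p`: the supremum of the mediation problem. -/
def mdValue {Ω A : Type*} [Fintype Ω] (uS : A → ℝ) (uR : Ω → A → ℝ) (p : stdSimplex ℝ Ω) : ℝ :=
  sSup {x | ∃ (V : stdSimplex ℝ Ω → ℝ) (τ : Measure (stdSimplex ℝ Ω)),
    IsFeasible uS uR p V τ ∧ x = ∫ μ, V μ ∂τ}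

/-- The virtual value function `V^g(μ) = (1 + ⟨g, μ - p⟩) V(μ)`. -/
def virtualValue {Ω : Type*} [Fintype Ω] (p : stdSimplex ℝ Ω) (V : stdSimplex ℝ Ω → ℝ)
    (g : Ω → ℝ) (μ : stdSimplex ℝ Ω) : ℝ :=
  (1 + ∑ ω, g ω * (μ ω - p ω)) * V μ

/-- The concavification of a bounded function `U` on the simplex: the pointwise infimum of all
concave functions on the simplex that majorize `U`. -/
def cav {Ω : Type*} [Fintype Ω] (U : stdSimplex ℝ Ω → ℝ) (q : stdSimplex ℝ Ω) : ℝ :=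
  sInf {y | ∃ f : (Ω → ℝ) → ℝ, ConcaveOn ℝ (stdSimplex ℝ Ω) f ∧
    (∀ μ : stdSimplex ℝ Ω, U μ ≤ f μ) ∧ y = f q}

section Game

/-- The joint probability of state `ω` and message `m` when the prior is `p`, the sender reports
according to `ρ` and the mediator sends messages according to the communication mechanism `σ`. -/
def jointProb {Ω R M : Type*} [Fintype Ω] [Fintype R] [Fintype M] (p : stdSimplex ℝ Ω)
    (σ : R → stdSimplex ℝ M) (ρ : Ω → stdSimplex ℝ R) (ω : Ω) (m : M) : ℝ :=
  p ω * ∑ r, ρ ω r * σ r m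

/-- The total probability of message `m`. -/
def messageProb {Ω R M : Type*} [Fintype Ω] [Fintype R] [Fintype M] (p : stdSimplex ℝ Ω)
    (σ : R → stdSimplex ℝ M) (ρ : Ω → stdSimplex ℝ R) (m : M) : ℝ :=
  ∑ ω, jointProb p σ ρ ω m

/-- The expected payoff of a player with utility `u` in the game induced by `σ`, when the sender
uses the reporting strategy `ρ` and the receiver uses the mixed action strategy `α`. -/
def gamePayoff {Ω R M A : Type*} [Fintype Ω] [Fintype R] [Fintype M] [MeasurableSpace A]
    (u : Ω → A → ℝ) (p : stdSimplex ℝ Ω) (σ : R → stdSimplex ℝ M)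
    (ρ : Ω → stdSimplex ℝ R) (α : M → ProbabilityMeasure A) : ℝ :=
  ∑ ω, ∑ m, jointProb p σ ρ ω m * ∫ a, u ω a ∂(α m : Measure A)

/-- `(ρ, α)` is a Bayes-Nash equilibrium of the communication game induced by `σ`. -/
structure IsEquilibrium {Ω R M A : Type*} [Fintype Ω] [Fintype R] [Fintype M] [MeasurableSpace A]
    (uS : A → ℝ) (uR : Ω → A → ℝ) (p : stdSimplex ℝ Ω) (σ : R → stdSimplex ℝ M)
    (ρ : Ω → stdSimplex ℝ R) (α : M → ProbabilityMeasure A) : Prop where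
  sender : ∀ ρ' : Ω → stdSimplex ℝ R,
    gamePayoff (fun _ => uS) p σ ρ' α ≤ gamePayoff (fun _ => uS) p σ ρ α
  receiver : ∀ α' : M → ProbabilityMeasure A,
    gamePayoff uR p σ ρ α' ≤ gamePayoff uR p σ ρ α

/-- The mechanism `σ` implements `(V, τ)`: its game has an equilibrium such that, with `β m` the
receiver's posterior after message `m` (pinned down by Bayes' rule whenever `m` has positive
probability), `τ` is the distribution of posteriors, and after every message of positive
probability the sender's expected utility is the value of `V` at the posterior. -/
def Implements {Ω R M A : Type*} [Fintype Ω] [Fintype R] [Fintype M] [MeasurableSpace A]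
    (uS : A → ℝ) (uR : Ω → A → ℝ) (p : stdSimplex ℝ Ω) (σ : R → stdSimplex ℝ M)
    (V : stdSimplex ℝ Ω → ℝ) (τ : Measure (stdSimplex ℝ Ω)) : Prop :=
  ∃ (ρ : Ω → stdSimplex ℝ R) (α : M → ProbabilityMeasure A) (β : M → stdSimplex ℝ Ω),
    IsEquilibrium uS uR p σ ρ α ∧
    (∀ m ω, messageProb p σ ρ m * β m ω = jointProb p σ ρ ω m) ∧
    τ = ∑ m, ENNReal.ofReal (messageProb p σ ρ m) • Measure.dirac (β m) ∧
    ∀ m, 0 < messageProb p σ ρ m → ∫ a, uS a ∂(α m : Measure A) = V (β m)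

end Game

end Mediation

end

/-! Each belief `μ` with a best response `a` gives a vector `(μ, uS a • (μ - p), uS a)`. These
vectors form a compact set, so their convex hull `K` is compact. A feasible pair has its barycentre
`(p, 0, ∫ V)` in `K`, and every point `(p, 0, v)` of `K` is a finite convex combination of such
vectors; hence the value is the largest height `v` of `K` over `(p, 0)`
(`exists_isGreatest_payoff`). A Carathéodory reduction (`IsSplitting.exists_card_le`) leaves at most
`2n - 1` vectors. Averaging those that share a belief yields `V`, and truth-telling makes the sender
indifferent among all reports to the direct mechanism (`exists_implements`). For the minimax
formula, truth-telling annihilates the `g`-term, so `V^g` averages to `v` for the optimal `V`,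
whence `cav (V^g) p ≥ v` for every `g`. For an arbitrary `V` and `t > v`, a hyperplane separating
`(p, 0, t)` from `K` supplies a `g` and an affine majorant of `V^g` equal to `t` at `p`
(`iInf_cav_le`). -/

theorem Fintype.sum_eq_sum_of_embedding {ι κ M : Type*} [Fintype ι] [Fintype κ] [AddCommMonoid M]
    (e : ι ↪ κ) {f : ι → M} {g : κ → M} (h₁ : ∀ i, g (e i) = f i)
    (h₂ : ∀ j, j ∉ Set.range e → g j = 0) : ∑ j, g j = ∑ i, f i :=
  (Finset.sum_of_injOn e e.injective.injOn (by simp) (fun j _ hj => h₂ j (by simpa using hj))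
    fun i _ => (h₁ i).symm).symm

/-- In a finite-dimensional space, the convex hull of a compact set is compact. -/
theorem IsCompact.convexHull_of_finiteDimensional {E : Type*} [NormedAddCommGroup E]
    [NormedSpace ℝ E] [FiniteDimensional ℝ E] {s : Set E} (hs : IsCompact s) :
    IsCompact (convexHull ℝ s) := by
  classical
  rcases s.eq_empty_or_nonempty with rfl | ⟨x₀, hx₀⟩
  · simp
  set N := Module.finrank ℝ E + 1 with hN
  set F : (Fin N → ℝ) × (Fin N → E) → E := fun q => ∑ i, q.1 i • q.2 i with hF
  have hFc : Continuous F := by fun_prop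
  -- By Carathéodory, `finrank + 1` points suffice, so the hull is a continuous image of one compact
  -- set. Shorter combinations are padded with weight `0` at `x₀`.
  have key : convexHull ℝ s = F '' (stdSimplex ℝ (Fin N) ×ˢ Set.univ.pi fun _ => s) := by
    apply Set.Subset.antisymm
    · intro x hx
      obtain ⟨ι, _, z, w, hz, hind, hw, hw1, hx⟩ := eq_pos_convex_span_of_mem_convexHull hx
      have hcard : Fintype.card ι ≤ Fintype.card (Fin N) := by
        simpa using hind.card_le_finrank_succ.trans
          (Nat.succ_le_succ (Submodule.finrank_le _))
      obtain ⟨e⟩ := Function.Embedding.nonempty_of_card_le hcard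
      refine ⟨(Function.extend e w 0, Function.extend e z fun _ => x₀), ⟨⟨fun j => ?_, ?_⟩, ?_⟩, ?_⟩
      · by_cases hj : ∃ i, e i = j
        · obtain ⟨i, rfl⟩ := hj
          simpa [e.injective.extend_apply] using (hw i).le
        · simp [Function.extend_apply' _ _ _ hj]
      · rw [← hw1]
        exact Fintype.sum_eq_sum_of_embedding e (fun i => e.injective.extend_apply _ _ _)
          (fun j hj => by simp [Function.extend_apply' w (0 : Fin N → ℝ) j hj])
      · intro j _
        by_cases hj : ∃ i, e i = j
        · obtain ⟨i, rfl⟩ := hj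
          simpa [e.injective.extend_apply] using hz ⟨i, rfl⟩
        · simpa [Function.extend_apply' _ _ _ hj] using hx₀
      · rw [← hx]
        exact Fintype.sum_eq_sum_of_embedding e (fun i => by simp [e.injective.extend_apply])
          (fun j hj => by simp [Function.extend_apply' w (0 : Fin N → ℝ) j hj])
    · rintro _ ⟨⟨w, z⟩, ⟨hw, hz⟩, rfl⟩
      exact mem_convexHull_of_exists_fintype w z hw.1 hw.2 (fun i => hz i trivial) rfl
  rw [key]
  exact ((isCompact_stdSimplex ℝ _).prod (isCompact_univ_pi fun _ => hs)).image hFc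

/-- Moving nonnegative weights in a direction with a negative entry until the first weight
vanishes. -/
theorem exists_nonneg_add_mul_eq_zero {ι : Type*} [Fintype ι] (w c : ι → ℝ) (hw : ∀ i, 0 ≤ w i)
    (hc : ∃ i, c i < 0) :
    ∃ t : ℝ, 0 ≤ t ∧ (∀ i, 0 ≤ w i + t * c i) ∧ ∃ i, w i + t * c i = 0 := by
  classical
  -- Ratio test: among the decreasing weights, the smallest `w i / -c i` is the first time one
  -- reaches zero.
  obtain ⟨i₀, hi₀, hmin⟩ := Finset.exists_min_image
    (Finset.univ.filter fun i => c i < 0) (fun i => w i / -c i) 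
    (by simpa [Finset.filter_nonempty_iff] using hc)
  simp only [Finset.mem_filter, Finset.mem_univ, true_and] at hi₀ hmin
  have ht : 0 ≤ w i₀ / -c i₀ := div_nonneg (hw _) (by linarith)
  refine ⟨w i₀ / -c i₀, ht, fun i => ?_, i₀, ?_⟩
  · rcases lt_or_ge (c i) 0 with h | h
    · have := hmin i h
      rw [le_div_iff₀ (by linarith)] at this
      linarith
    · have := hw i
      positivity
  · have : c i₀ ≠ 0 := hi₀.ne
    field_simp
    ring

namespace Mediation

/-! ### Reducing finite splittings to `2n - 1` points -/

section Splittings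

variable {Ω A : Type*} [Fintype Ω]

/-- A finite family of weighted beliefs, each with a best response of the receiver, that satisfies
Bayes plausibility and truth-telling. -/
structure IsSplitting (uS : A → ℝ) (uR : Ω → A → ℝ) (p : stdSimplex ℝ Ω) {ι : Type*} [Fintype ι]
    (w : ι → ℝ) (μ : ι → stdSimplex ℝ Ω) (a : ι → A) : Prop where
  nonneg : ∀ i, 0 ≤ w i
  best : ∀ i, a i ∈ bestResponses uR (μ i)
  bayes : ∀ ω, ∑ i, w i * μ i ω = p ω
  truth : ∀ ω, ∑ i, w i * (uS (a i) * (μ i ω - p ω)) = 0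

theorem sum_mul_belief {ι : Type*} [Fintype ι] (c : ι → ℝ) (μ : ι → stdSimplex ℝ Ω) :
    ∑ ω, ∑ i, c i * μ i ω = ∑ i, c i := by
  rw [Finset.sum_comm]
  simp [← Finset.mul_sum]

theorem IsSplitting.sum_weights {uS : A → ℝ} {uR : Ω → A → ℝ} {p : stdSimplex ℝ Ω} {ι : Type*}
    [Fintype ι] {w : ι → ℝ} {μ : ι → stdSimplex ℝ Ω} {a : ι → A}
    (h : IsSplitting uS uR p w μ a) : ∑ i, w i = 1 := by
  rw [← sum_mul_belief w μ]
  simp [h.bayes]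

/-- More than `2n - 1` points of `Δ(Ω) × ℝ` satisfy a nontrivial linear relation that preserves
Bayes plausibility and truth-telling. -/
theorem exists_relation (p : stdSimplex ℝ Ω) {N : ℕ} (hN : 2 * Fintype.card Ω - 1 < N)
    (μ : Fin N → stdSimplex ℝ Ω) (s : Fin N → ℝ) :
    ∃ c : Fin N → ℝ, (∀ ω, ∑ i, c i * μ i ω = 0) ∧ (∀ ω, ∑ i, c i * (s i * (μ i ω - p ω)) = 0) ∧
      ∃ i, c i ≠ 0 := by
  classical
  have : Nonempty Ω := by
    by_contra h
    rw [not_nonempty_iff] at h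
    simpa using stdSimplex.sum_eq_one p
  obtain ⟨ω₀⟩ := this
  -- One truth-telling coordinate is dropped, so the target has dimension `n + (n - 1)`. The dropped
  -- equation returns because the coordinates of `μ i - p` sum to zero.
  let z : Fin N → (Ω → ℝ) × ({ω // ω ≠ ω₀} → ℝ) :=
    fun i => (⇑(μ i), fun ω => s i * (μ i ω - p ω))
  have hnot : ¬ LinearIndependent ℝ z := by
    intro h
    have h1 := h.fintype_card_le_finrank
    have h2 : Fintype.card {ω // ω ≠ ω₀} = Fintype.card Ω - 1 := by
      simp [Fintype.card_subtype_compl]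
    have h3 : 0 < Fintype.card Ω := Fintype.card_pos_iff.2 ⟨ω₀⟩
    simp only [Module.finrank_prod, Module.finrank_fintype_fun_eq_card, Fintype.card_fin, h2] at h1
    omega
  obtain ⟨c, hc, i, hi⟩ := Fintype.not_linearIndependent_iff.1 hnot
  have h1 : ∀ ω, ∑ i, c i * μ i ω = 0 := fun ω => by
    have := congrArg (fun x => x.1 ω) hc
    simpa [z, Prod.fst_sum, Finset.sum_apply] using this
  have h2 : ∀ ω, ω ≠ ω₀ → ∑ i, c i * (s i * (μ i ω - p ω)) = 0 := fun ω hω => by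
    have := congrArg (fun x => x.2 ⟨ω, hω⟩) hc
    simpa [z, Prod.snd_sum, Finset.sum_apply] using this
  have h3 : ∑ ω, ∑ i, c i * (s i * (μ i ω - p ω)) = 0 := by
    rw [Finset.sum_comm]
    simp [← Finset.mul_sum]
  refine ⟨c, h1, fun ω => ?_, i, hi⟩
  by_cases hω : ω = ω₀
  · subst hω
    rwa [Finset.sum_eq_single ω (fun b _ hb => h2 b hb) (by simp)] at h3
  · exact h2 ω hω

/-- Every splitting is weakly improved by one with at most `2n - 1` points. -/
theorem IsSplitting.exists_card_le {uS : A → ℝ} {uR : Ω → A → ℝ} {p : stdSimplex ℝ Ω} :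
    ∀ {N : ℕ} {w : Fin N → ℝ} {μ : Fin N → stdSimplex ℝ Ω} {a : Fin N → A},
      IsSplitting uS uR p w μ a →
      ∃ k ≤ 2 * Fintype.card Ω - 1, ∃ (w' : Fin k → ℝ) (μ' : Fin k → stdSimplex ℝ Ω)
        (a' : Fin k → A), IsSplitting uS uR p w' μ' a' ∧
          ∑ i, w i * uS (a i) ≤ ∑ i, w' i * uS (a' i) := by
  intro N
  induction N with
  | zero => exact fun {w μ a} h => ⟨0, Nat.zero_le _, w, μ, a, h, le_rfl⟩
  | succ N ih =>
    intro w μ a h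
    by_cases hN : N + 1 ≤ 2 * Fintype.card Ω - 1
    · exact ⟨N + 1, hN, w, μ, a, h, le_rfl⟩
    -- The payoff need not be preserved: the sign of the relation is chosen so that it does not
    -- fall, which saves one dimension.
    obtain ⟨c, hc1, hc2, hc3, i, hi⟩ : ∃ c : Fin (N + 1) → ℝ, (∀ ω, ∑ i, c i * μ i ω = 0) ∧
        (∀ ω, ∑ i, c i * (uS (a i) * (μ i ω - p ω)) = 0) ∧ 0 ≤ ∑ i, c i * uS (a i) ∧
        ∃ i, c i ≠ 0 := by
      obtain ⟨c, hc1, hc2, i, hi⟩ := exists_relation p (not_le.1 hN) μ fun i => uS (a i)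
      rcases le_total 0 (∑ i, c i * uS (a i)) with h0 | h0
      · exact ⟨c, hc1, hc2, h0, i, hi⟩
      · refine ⟨-c, fun ω => ?_, fun ω => ?_, ?_, i, by simpa using hi⟩
        · simpa using hc1 ω
        · simpa using hc2 ω
        · simpa using h0
    have hc0 : ∑ i, c i = 0 := by
      rw [← sum_mul_belief c μ]
      simp [hc1]
    have hneg : ∃ i, c i < 0 := by
      by_contra! hpos
      exact hi ((Finset.sum_eq_zero_iff_of_nonneg fun i _ => hpos i).1 hc0 i (Finset.mem_univ i))
    obtain ⟨t, ht, hw', j, hj⟩ := exists_nonneg_add_mul_eq_zero w c h.nonneg hneg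
    -- The `j`-th new weight is zero, so deleting `j` changes no weighted sum.
    have hsum : ∀ f : Fin (N + 1) → ℝ, ∑ i, (w (j.succAbove i) + t * c (j.succAbove i)) *
        f (j.succAbove i) = ∑ i, w i * f i + t * ∑ i, c i * f i := by
      intro f
      have := Fin.sum_univ_succAbove (fun i => (w i + t * c i) * f i) j
      rw [hj, zero_mul, zero_add] at this
      rw [← this, Finset.mul_sum, ← Finset.sum_add_distrib]
      exact Finset.sum_congr rfl fun i _ => by ring
    have hsplit : IsSplitting uS uR p
        (fun i => w (j.succAbove i) + t * c (j.succAbove i)) (fun i => μ (j.succAbove i))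
        (fun i => a (j.succAbove i)) :=
      { nonneg := fun i => hw' _
        best := fun i => h.best _
        bayes := fun ω => by rw [hsum fun i => μ i ω, h.bayes, hc1]; simp
        truth := fun ω => by
          rw [hsum fun i => uS (a i) * (μ i ω - p ω), h.truth, hc2]; simp }
    obtain ⟨k, hk, w', μ', a', h', hle⟩ := ih hsplit
    refine ⟨k, hk, w', μ', a', h', le_trans ?_ hle⟩
    rw [hsum fun i => uS (a i)]
    exact le_add_of_nonneg_right (mul_nonneg ht hc3)

end Splittings

/-! ### Selections and the compact hull of outcomes -/

section Selections

variable {Ω A : Type*} [Fintype Ω] {uS : A → ℝ} {uR : Ω → A → ℝ}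

theorem continuous_belief_apply (ω : Ω) : Continuous fun μ : stdSimplex ℝ Ω => μ ω :=
  (continuous_apply ω).comp continuous_subtype_val

theorem isClosed_bestResponses_graph [MetricSpace A] (hR : ∀ ω, Continuous (uR ω)) :
    IsClosed {x : stdSimplex ℝ Ω × A | x.2 ∈ bestResponses uR x.1} := by
  have h : {x : stdSimplex ℝ Ω × A | x.2 ∈ bestResponses uR x.1} =
      ⋂ a', {x | ∑ ω, x.1 ω * uR ω a' ≤ ∑ ω, x.1 ω * uR ω x.2} := by
    ext x
    simp [bestResponses]
  rw [h]
  refine isClosed_iInter fun a' => isClosed_le ?_ ?_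
  · exact continuous_finsetSum _ fun ω _ =>
      ((continuous_belief_apply ω).comp continuous_fst).mul continuous_const
  · exact continuous_finsetSum _ fun ω _ =>
      ((continuous_belief_apply ω).comp continuous_fst).mul ((hR ω).comp continuous_snd)

theorem isCompact_bestResponses [MetricSpace A] [CompactSpace A]
    (hR : ∀ ω, Continuous (uR ω)) (μ : stdSimplex ℝ Ω) :
    IsCompact (bestResponses uR μ) :=
  ((isClosed_bestResponses_graph hR).preimage (Continuous.prodMk_right μ)).isCompact

theorem bestResponses_nonempty [MetricSpace A] [CompactSpace A] [Nonempty A]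
    (hR : ∀ ω, Continuous (uR ω)) (μ : stdSimplex ℝ Ω) :
    (bestResponses uR μ).Nonempty := by
  obtain ⟨a, -, ha⟩ := isCompact_univ.exists_isMaxOn Set.univ_nonempty
    (f := fun a => ∑ ω, μ ω * uR ω a)
    (continuous_finsetSum _ fun ω _ => continuous_const.mul (hR ω)).continuousOn
  exact ⟨a, fun a' => ha (Set.mem_univ a')⟩

/-- The sender-preferred value is a measurable selection. -/
theorem exists_isMeasurableSelection [MetricSpace A] [CompactSpace A] [Nonempty A]
    (hS : Continuous uS)
    (hR : ∀ ω, Continuous (uR ω)) : ∃ V, IsMeasurableSelection uS uR V := by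
  have hc : ∀ μ, IsCompact (uS '' bestResponses uR μ) :=
    fun μ => (isCompact_bestResponses hR μ).image hS
  have hmem : ∀ μ, sSup (uS '' bestResponses uR μ) ∈ uS '' bestResponses uR μ :=
    fun μ => (hc μ).sSup_mem ((bestResponses_nonempty hR μ).image _)
  refine ⟨fun μ => sSup (uS '' bestResponses uR μ), measurable_of_Ici fun c => ?_,
    fun μ => subset_convexHull ℝ _ (hmem μ)⟩
  -- Upper level sets are projections of compact sets, hence closed.
  have h : (fun μ => sSup (uS '' bestResponses uR μ)) ⁻¹' Set.Ici c =
      Prod.fst '' ({x : stdSimplex ℝ Ω × A | x.2 ∈ bestResponses uR x.1} ∩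
        {x | c ≤ uS x.2}) := by
    ext μ
    constructor
    · intro h
      obtain ⟨a, ha, hau⟩ := hmem μ
      exact ⟨(μ, a), ⟨ha, show c ≤ uS a by rw [hau]; exact h⟩, rfl⟩
    · rintro ⟨⟨μ, a⟩, ⟨ha, hca⟩, rfl⟩
      exact le_csSup_of_le (hc μ).bddAbove ⟨a, ha, rfl⟩ hca
  rw [h]
  refine IsClosed.measurableSet (IsCompact.isClosed (IsCompact.image ?_ continuous_fst))
  exact ((isClosed_bestResponses_graph hR).inter
    (isClosed_le continuous_const (hS.comp continuous_snd))).isCompact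

theorem exists_abs_le_of_mem_valueCorr [MetricSpace A] [CompactSpace A]
    (hS : Continuous uS) (uR : Ω → A → ℝ) :
    ∃ C : ℝ, ∀ (μ : stdSimplex ℝ Ω), ∀ s ∈ valueCorr uS uR μ, |s| ≤ C := by
  obtain ⟨C, hC⟩ := isCompact_univ.exists_bound_of_continuousOn hS.continuousOn
  refine ⟨C, fun μ s hs => ?_⟩
  have : valueCorr uS uR μ ⊆ Set.Icc (-C) C := by
    refine convexHull_min ?_ (convex_Icc _ _)
    rintro _ ⟨a, -, rfl⟩
    exact abs_le.1 (hC a (Set.mem_univ a))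
  exact abs_le.2 (this hs)

/-- The vectors `(μ, s (μ - p), s)` for the sender utilities `s` of best responses at `μ`. -/
def outcomes (uS : A → ℝ) (uR : Ω → A → ℝ) (p : stdSimplex ℝ Ω) :
    Set ((Ω → ℝ) × (Ω → ℝ) × ℝ) :=
  (fun x : stdSimplex ℝ Ω × A => (⇑x.1, (fun ω => uS x.2 * (x.1 ω - p ω)), uS x.2)) ''
    {x | x.2 ∈ bestResponses uR x.1}

theorem isCompact_convexHull_outcomes [MetricSpace A] [CompactSpace A]
    (hS : Continuous uS) (hR : ∀ ω, Continuous (uR ω))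
    (p : stdSimplex ℝ Ω) : IsCompact (convexHull ℝ (outcomes uS uR p)) := by
  refine IsCompact.convexHull_of_finiteDimensional
    ((isClosed_bestResponses_graph hR).isCompact.image ?_)
  have h : Continuous fun x : stdSimplex ℝ Ω × A => uS x.2 := hS.comp continuous_snd
  have h' : ∀ ω, Continuous fun x : stdSimplex ℝ Ω × A => x.1 ω :=
    fun ω => (continuous_belief_apply ω).comp continuous_fst
  exact (continuous_pi h').prodMk
    ((continuous_pi fun ω => h.mul ((h' ω).sub continuous_const)).prodMk h)

/-- For fixed `μ` the vector is affine in `s`, so the admissible `s` form a convex set containing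
the utilities of all best responses. -/
theorem mem_convexHull_outcomes (p μ : stdSimplex ℝ Ω) {s : ℝ} (hs : s ∈ valueCorr uS uR μ) :
    ((⇑μ, (fun ω => s * (μ ω - p ω)), s) : (Ω → ℝ) × (Ω → ℝ) × ℝ) ∈
      convexHull ℝ (outcomes uS uR p) := by
  have hsub : valueCorr uS uR μ ⊆ {s : ℝ | ((⇑μ, (fun ω => s * (μ ω - p ω)), s) :
      (Ω → ℝ) × (Ω → ℝ) × ℝ) ∈ convexHull ℝ (outcomes uS uR p)} := by
    refine convexHull_min ?_ ?_
    · rintro _ ⟨a, ha, rfl⟩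
      exact subset_convexHull ℝ _ ⟨(μ, a), ha, rfl⟩
    · intro x hx y hy b c hb hc hbc
      show ((⇑μ, (fun ω => (b • x + c • y) * (μ ω - p ω)), b • x + c • y) :
        (Ω → ℝ) × (Ω → ℝ) × ℝ) ∈ convexHull ℝ (outcomes uS uR p)
      convert convex_convexHull ℝ (outcomes uS uR p) hx hy hb hc hbc using 1
      refine Prod.ext ?_ (Prod.ext ?_ rfl)
      · ext ω
        simp [← add_mul, hbc]
      · ext ω
        simp only [Prod.snd_add, Prod.fst_add, Prod.smul_snd, Prod.smul_fst, Pi.add_apply,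
          Pi.smul_apply, smul_eq_mul]
        ring
  exact hsub hs

/-- The payoff of a feasible pair is a coordinate of a point of the convex hull of outcomes. -/
theorem IsFeasible.mem_convexHull [MetricSpace A] [CompactSpace A]
    (hS : Continuous uS) (hR : ∀ ω, Continuous (uR ω))
    {p : stdSimplex ℝ Ω} {V : stdSimplex ℝ Ω → ℝ} {τ : Measure (stdSimplex ℝ Ω)}
    (h : IsFeasible uS uR p V τ) :
    ((⇑p, 0, ∫ μ, V μ ∂τ) : (Ω → ℝ) × (Ω → ℝ) × ℝ) ∈ convexHull ℝ (outcomes uS uR p) := by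
  have := h.isProbability
  obtain ⟨C, hC⟩ := exists_abs_le_of_mem_valueCorr hS uR
  have hV : Integrable V τ := Integrable.of_bound h.selection.measurable.aestronglyMeasurable C
    (Filter.Eventually.of_forall fun μ => hC μ _ (h.selection.mem μ))
  have hb : ∀ ω, Integrable (fun μ : stdSimplex ℝ Ω => μ ω) τ := fun ω =>
    Integrable.of_bound (continuous_belief_apply ω).aestronglyMeasurable 1
      (Filter.Eventually.of_forall fun μ => by
        rw [Real.norm_eq_abs, abs_of_nonneg (stdSimplex.zero_le μ ω)]
        exact stdSimplex.le_one μ ω)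
  have hVb : ∀ ω, Integrable (fun μ : stdSimplex ℝ Ω => V μ * (μ ω - p ω)) τ := fun ω =>
    ((hb ω).sub (integrable_const _)).bdd_mul h.selection.measurable.aestronglyMeasurable
      (Filter.Eventually.of_forall fun μ => hC μ _ (h.selection.mem μ))
  have h1 : Integrable (fun μ : stdSimplex ℝ Ω => (⇑μ : Ω → ℝ)) τ := Integrable.of_eval hb
  have h2 : Integrable (fun μ : stdSimplex ℝ Ω => fun ω => V μ * (μ ω - p ω)) τ :=
    Integrable.of_eval hVb
  have hmem := (convex_convexHull ℝ (outcomes uS uR p)).integral_mem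
    (isCompact_convexHull_outcomes hS hR p).isClosed
    (Filter.Eventually.of_forall fun μ => mem_convexHull_outcomes p μ (h.selection.mem μ))
    (h1.prodMk (h2.prodMk hV))
  rw [integral_pair h1 (h2.prodMk hV), integral_pair h2 hV] at hmem
  convert hmem using 2
  · ext ω
    rw [eval_integral hb, h.bayesPlausible]
  · congr 1
    ext ω
    rw [eval_integral hVb, h.truthTelling]
    rfl

theorem exists_isSplitting {p : stdSimplex ℝ Ω} {v : ℝ}
    (h : ((⇑p, 0, v) : (Ω → ℝ) × (Ω → ℝ) × ℝ) ∈ convexHull ℝ (outcomes uS uR p)) :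
    ∃ (N : ℕ) (w : Fin N → ℝ) (μ : Fin N → stdSimplex ℝ Ω) (a : Fin N → A),
      IsSplitting uS uR p w μ a ∧ ∑ i, w i * uS (a i) = v := by
  obtain ⟨ι, _, w, z, hw, -, hz, hx⟩ := mem_convexHull_iff_exists_fintype.1 h
  choose x hxb hxz using hz
  obtain rfl : (fun i => _) = z := funext hxz
  let e := (Fintype.equivFin ι).symm
  refine ⟨Fintype.card ι, fun i => w (e i), fun i => (x (e i)).1, fun i => (x (e i)).2,
    ⟨fun i => hw _, fun i => hxb _, fun ω => ?_, fun ω => ?_⟩, ?_⟩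
  · rw [e.sum_comp fun i => w i * (x i).1 ω]
    simpa [Prod.fst_sum, Finset.sum_apply] using congrArg (fun y => y.1 ω) hx
  · rw [e.sum_comp fun i => w i * (uS (x i).2 * ((x i).1 ω - p ω))]
    simpa [Prod.fst_sum, Prod.snd_sum, Finset.sum_apply] using congrArg (fun y => y.2.1 ω) hx
  · rw [e.sum_comp fun i => w i * uS (x i).2]
    simpa [Prod.snd_sum] using congrArg (fun y => y.2.2) hx

/-- The largest payoff among the points of the convex hull of outcomes that satisfy Bayes
plausibility and truth-telling. -/
theorem exists_isGreatest_payoff [MetricSpace A] [CompactSpace A] [Nonempty A]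
    (hS : Continuous uS) (hR : ∀ ω, Continuous (uR ω))
    (p : stdSimplex ℝ Ω) : ∃ v, IsGreatest
      {v : ℝ | ((⇑p, 0, v) : (Ω → ℝ) × (Ω → ℝ) × ℝ) ∈ convexHull ℝ (outcomes uS uR p)} v := by
  have hcomp := isCompact_convexHull_outcomes hS hR p
  refine IsCompact.exists_isGreatest ?_ ?_
  · refine IsCompact.of_isClosed_subset (hcomp.image (continuous_snd.comp continuous_snd))
      (hcomp.isClosed.preimage (by fun_prop)) fun v hv => ⟨_, hv, rfl⟩
  -- No disclosure is feasible: at belief `p` the truth-telling vector vanishes.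
  · obtain ⟨a, ha⟩ := bestResponses_nonempty hR p
    refine ⟨uS a, subset_convexHull ℝ _ ⟨(p, a), ha, ?_⟩⟩
    refine Prod.ext rfl (Prod.ext ?_ rfl)
    ext ω
    simp

end Selections

/-! ### Concavification and weak duality -/

section Concavification

variable {Ω A : Type*} [Fintype Ω]

theorem mem_lowerBounds_cav (U : stdSimplex ℝ Ω → ℝ) (q : stdSimplex ℝ Ω) :
    U q ∈ lowerBounds {y | ∃ f : (Ω → ℝ) → ℝ, ConcaveOn ℝ (stdSimplex ℝ Ω) f ∧
      (∀ μ : stdSimplex ℝ Ω, U μ ≤ f μ) ∧ y = f q} := by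
  rintro _ ⟨f, -, hf, rfl⟩
  exact hf q

theorem cav_le {U : stdSimplex ℝ Ω → ℝ} {f : (Ω → ℝ) → ℝ} (hf : ConcaveOn ℝ (stdSimplex ℝ Ω) f)
    (hU : ∀ μ : stdSimplex ℝ Ω, U μ ≤ f μ) (q : stdSimplex ℝ Ω) : cav U q ≤ f q :=
  csInf_le ⟨_, mem_lowerBounds_cav U q⟩ ⟨f, hf, hU, rfl⟩

/-- Jensen's inequality for each concave majorant. The bound `C` provides a majorant, so that the
infimum is not over the empty set. -/
theorem sum_le_cav {U : stdSimplex ℝ Ω → ℝ} {C : ℝ} (hC : ∀ μ, U μ ≤ C) {ι : Type*} [Fintype ι]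
    {w : ι → ℝ} (hw : ∀ i, 0 ≤ w i) (hw1 : ∑ i, w i = 1) {μ : ι → stdSimplex ℝ Ω}
    {q : stdSimplex ℝ Ω} (hq : ∀ ω, ∑ i, w i * μ i ω = q ω) :
    ∑ i, w i * U (μ i) ≤ cav U q := by
  refine le_csInf ⟨C, fun _ => C, concaveOn_const C (convex_stdSimplex ℝ Ω), hC, rfl⟩ ?_
  rintro _ ⟨f, hf, hU, rfl⟩
  have h := hf.le_map_sum (t := Finset.univ) (p := fun i => (⇑(μ i) : Ω → ℝ))
    (fun i _ => hw i) hw1 (fun i _ => (μ i).2)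
  have hsum : ∑ i, w i • (⇑(μ i) : Ω → ℝ) = ⇑q := by
    ext ω
    simpa [Finset.sum_apply] using hq ω
  rw [hsum] at h
  exact (Finset.sum_le_sum fun i _ => mul_le_mul_of_nonneg_left (hU _) (hw i)).trans h

theorem virtualValue_le {p : stdSimplex ℝ Ω} {V : stdSimplex ℝ Ω → ℝ} {C : ℝ}
    (hV : ∀ μ, |V μ| ≤ C) (g : Ω → ℝ)
    (μ : stdSimplex ℝ Ω) :
    virtualValue p V g μ ≤ (1 + ∑ ω, |g ω|) * C := by
  have h : |1 + ∑ ω, g ω * (μ ω - p ω)| ≤ 1 + ∑ ω, |g ω| := by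
    refine (abs_add_le _ _).trans ?_
    rw [abs_one]
    gcongr
    refine (Finset.abs_sum_le_sum_abs _ _).trans (Finset.sum_le_sum fun ω _ => ?_)
    rw [abs_mul]
    refine mul_le_of_le_one_right (abs_nonneg _) (abs_le.2 ⟨?_, ?_⟩)
    · linarith [stdSimplex.zero_le μ ω, stdSimplex.le_one p ω]
    · linarith [stdSimplex.zero_le p ω, stdSimplex.le_one μ ω]
  refine (le_abs_self _).trans ?_
  rw [virtualValue, abs_mul]
  exact mul_le_mul h (hV μ) (abs_nonneg _) ((abs_nonneg _).trans h)

/-- At `μ = p` the factor of `V` is `1`. This bound, independent of `g`, makes the infimum over `g`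
bounded below. -/
theorem le_cav_virtualValue {p : stdSimplex ℝ Ω} {V : stdSimplex ℝ Ω → ℝ} {C : ℝ}
    (hV : ∀ μ, |V μ| ≤ C) (g : Ω → ℝ) : V p ≤ cav (virtualValue p V g) p := by
  refine le_csInf ⟨_, fun _ => _, concaveOn_const _ (convex_stdSimplex ℝ Ω),
    virtualValue_le hV g, rfl⟩ fun y hy => ?_
  have := mem_lowerBounds_cav _ _ hy
  simpa [virtualValue] using this

/-- Weak duality: no selection has virtual values whose concavifications all exceed the largest
payoff at the prior. -/
theorem iInf_cav_le [MetricSpace A] [CompactSpace A] {uS : A → ℝ} {uR : Ω → A → ℝ}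
    (hS : Continuous uS) (hR : ∀ ω, Continuous (uR ω))
    {p : stdSimplex ℝ Ω} {v : ℝ} (hv : IsGreatest
      {v : ℝ | ((⇑p, 0, v) : (Ω → ℝ) × (Ω → ℝ) × ℝ) ∈ convexHull ℝ (outcomes uS uR p)} v)
    {V : stdSimplex ℝ Ω → ℝ} (hV : IsMeasurableSelection uS uR V) :
    ⨅ g : Ω → ℝ, cav (virtualValue p V g) p ≤ v := by
  classical
  obtain ⟨C, hC⟩ := exists_abs_le_of_mem_valueCorr hS uR
  refine le_of_forall_gt_imp_ge_of_dense fun t ht => ?_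
  have hbdd : BddBelow (Set.range fun g : Ω → ℝ => cav (virtualValue p V g) p) := by
    refine ⟨V p, ?_⟩
    rintro _ ⟨g, rfl⟩
    exact le_cav_virtualValue (fun μ => hC μ _ (hV.mem μ)) g
  obtain ⟨φ, u, hφ, hu⟩ := geometric_hahn_banach_closed_point
    (convex_convexHull ℝ (outcomes uS uR p)) (isCompact_convexHull_outcomes hS hR p).isClosed
    (x := (⇑p, 0, t)) fun hmem => (hv.2 hmem).not_gt ht
  set h : (Ω → ℝ) →ₗ[ℝ] ℝ := φ.toLinearMap ∘ₗ LinearMap.inl ℝ _ _ with hh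
  set c : ℝ := φ (0, 0, 1) with hc
  set g : Ω → ℝ := fun ω => φ (0, Pi.single ω 1, 0) with hg
  have hdec : ∀ (x y : Ω → ℝ) (s : ℝ), φ (x, y, s) = h x + ∑ ω, g ω * y ω + c * s := by
    intro x y s
    have e1 : ((x, y, s) : (Ω → ℝ) × (Ω → ℝ) × ℝ) =
        (x, 0, 0) + ∑ ω, y ω • ((0, Pi.single ω 1, 0) : (Ω → ℝ) × (Ω → ℝ) × ℝ) +
          s • (0, 0, 1) := by
      refine Prod.ext ?_ (Prod.ext ?_ ?_)
      · simp [Prod.fst_sum]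
      · ext ω
        simp [Prod.fst_sum, Prod.snd_sum, Finset.sum_apply, Pi.single_apply]
      · simp [Prod.snd_sum]
    rw [e1, map_add, map_add, map_sum]
    simp only [map_smul, smul_eq_mul, hh, hc, hg, LinearMap.comp_apply, LinearMap.inl_apply,
      ContinuousLinearMap.coe_coe]
    congr 1
    · congr 1
      exact Finset.sum_congr rfl fun ω _ => mul_comm _ _
    · exact mul_comm _ _
  have hlt : ∀ x ∈ convexHull ℝ (outcomes uS uR p), φ x < φ (⇑p, 0, t) :=
    fun x hx => (hφ x hx).trans hu
  -- The points `(p, 0, v)` and `(p, 0, t)` differ only in height, and `v < t`.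
  have hcpos : 0 < c := by
    have := hlt _ hv.1
    simp only [hdec] at this
    nlinarith
  -- Dividing the separating inequality by `c` turns it into an affine majorant of a virtual value.
  have hmaj : ∀ μ : stdSimplex ℝ Ω, virtualValue p V (c⁻¹ • g) μ ≤ t + c⁻¹ * (h p - h μ) := by
    intro μ
    have := (hlt _ (mem_convexHull_outcomes p μ (hV.mem μ))).le
    simp only [hdec, Pi.zero_apply, mul_zero, Finset.sum_const_zero, add_zero] at this
    have e2 : ∑ ω, g ω * (V μ * (μ ω - p ω)) = V μ * ∑ ω, g ω * (μ ω - p ω) := by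
      rw [Finset.mul_sum]
      exact Finset.sum_congr rfl fun ω _ => by ring
    have e3 : ∑ ω, (c⁻¹ • g) ω * (μ ω - p ω) = c⁻¹ * ∑ ω, g ω * (μ ω - p ω) := by
      rw [Finset.mul_sum]
      exact Finset.sum_congr rfl fun ω _ => by simp [mul_assoc]
    rw [e2] at this
    rw [virtualValue, e3]
    have h4 := mul_le_mul_of_nonneg_left this (inv_pos.2 hcpos).le
    have h5 : c⁻¹ * c = 1 := inv_mul_cancel₀ hcpos.ne'
    linear_combination h4 + (t - V μ) * h5
  refine (ciInf_le hbdd (c⁻¹ • g)).trans ?_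
  have hcav := cav_le (f := fun x => t + c⁻¹ * (h p - h x)) ?_ hmaj p
  · simpa using hcav
  · refine ⟨convex_stdSimplex ℝ Ω, fun x _ y _ a b _ _ hab => le_of_eq ?_⟩
    simp only [map_add, map_smul, smul_eq_mul]
    linear_combination (t + c⁻¹ * h p) * hab

end Concavification

/-! ### Finitely supported measures -/

section FiniteSupport

variable {X ι : Type*} [Fintype ι] [MeasurableSpace X]

theorem integral_sum_smul_dirac {w : ι → ℝ} (hw : ∀ i, 0 ≤ w i) (x : ι → X) {f : X → ℝ}
    (hf : StronglyMeasurable f) :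
    ∫ y, f y ∂(∑ i, ENNReal.ofReal (w i) • Measure.dirac (x i)) = ∑ i, w i * f (x i) := by
  rw [integral_finsetSum_measure fun i _ =>
    (integrable_dirac' hf (by simp)).smul_measure ENNReal.ofReal_ne_top]
  refine Finset.sum_congr rfl fun i _ => ?_
  rw [integral_smul_measure, integral_dirac' _ _ hf, ENNReal.toReal_ofReal (hw i), smul_eq_mul]

theorem isProbabilityMeasure_sum_smul_dirac {w : ι → ℝ} (hw : ∀ i, 0 ≤ w i) (hw1 : ∑ i, w i = 1)
    (x : ι → X) :
    IsProbabilityMeasure (∑ i, ENNReal.ofReal (w i) • Measure.dirac (x i)) := by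
  constructor
  simp [Measure.finsetSum_apply, ← ENNReal.ofReal_sum_of_nonneg fun i _ => hw i, hw1]

end FiniteSupport

variable {Ω A : Type*} [Fintype Ω] {uS : A → ℝ} {uR : Ω → A → ℝ}

/-- Every value of the correspondence is the sender's expected utility under a mixed best response
of the receiver. -/
theorem exists_mixed_bestResponse [MetricSpace A] [MeasurableSpace A] [BorelSpace A]
    (hS : Continuous uS) (hR : ∀ ω, Continuous (uR ω)) {μ : stdSimplex ℝ Ω} {s : ℝ}
    (hs : s ∈ valueCorr uS uR μ) :
    ∃ α : ProbabilityMeasure A, ∫ a, uS a ∂(α : Measure A) = s ∧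
      ∀ α' : ProbabilityMeasure A, (∀ ω, Integrable (uR ω) (α' : Measure A)) →
        ∑ ω, μ ω * ∫ a, uR ω a ∂(α' : Measure A) ≤ ∑ ω, μ ω * ∫ a, uR ω a ∂(α : Measure A) := by
  obtain ⟨ι, _, w, z, hw, hw1, hz, hsum⟩ := mem_convexHull_iff_exists_fintype.1 hs
  choose a ha haz using hz
  have hprob := isProbabilityMeasure_sum_smul_dirac hw hw1 a
  have hint := fun {f : A → ℝ} (hf : Continuous f) =>
    integral_sum_smul_dirac hw a hf.measurable.stronglyMeasurable
  refine ⟨⟨_, hprob⟩, ?_, fun α' hα' => ?_⟩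
  · simpa [hint hS, haz] using hsum
  · obtain ⟨i₀, -⟩ : ∃ i, w i ≠ 0 := by
      by_contra! h
      simp [h] at hw1
    -- All best responses at `μ` give the receiver the same utility, so any index serves as
    -- reference.
    have hval : ∀ i, ∑ ω, μ ω * uR ω (a i) = ∑ ω, μ ω * uR ω (a i₀) :=
      fun i => le_antisymm (ha i₀ _) (ha i _)
    have h1 : ∑ ω, μ ω * ∫ b, uR ω b ∂(α' : Measure A) ≤ ∑ ω, μ ω * uR ω (a i₀) := by
      have h2 : ∑ ω, μ ω * ∫ b, uR ω b ∂(α' : Measure A) =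
          ∫ b, ∑ ω, μ ω * uR ω b ∂(α' : Measure A) := by
        rw [integral_finsetSum _ fun ω _ => (hα' ω).const_mul _]
        simp [integral_const_mul]
      rw [h2]
      refine (integral_mono (integrable_finsetSum _ fun ω _ => (hα' ω).const_mul _)
        (integrable_const _) (ha i₀)).trans_eq ?_
      simp
    refine h1.trans_eq ?_
    simp only [ProbabilityMeasure.coe_mk, hint (hR _), Finset.mul_sum]
    rw [Finset.sum_comm]
    have h3 : ∀ i, ∑ ω, μ ω * (w i * uR ω (a i)) = w i * ∑ ω, μ ω * uR ω (a i₀) := fun i => by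
      rw [← hval i, Finset.mul_sum]
      exact Finset.sum_congr rfl fun ω _ => by ring
    simp [h3, ← Finset.sum_mul, hw1]

/-- Averaging the sender's utilities of a splitting at each belief gives a measurable selection. -/
theorem IsSplitting.exists_selection [MetricSpace A] [CompactSpace A] [Nonempty A]
    (hS : Continuous uS) (hR : ∀ ω, Continuous (uR ω)) {p : stdSimplex ℝ Ω} {ι : Type*} [Fintype ι]
    {w : ι → ℝ} {μ : ι → stdSimplex ℝ Ω} {a : ι → A} (h : IsSplitting uS uR p w μ a) :
    ∃ V, IsMeasurableSelection uS uR V ∧ ∀ f : stdSimplex ℝ Ω → ℝ,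
      ∑ i, w i * (V (μ i) * f (μ i)) = ∑ i, w i * (uS (a i) * f (μ i)) := by
  classical
  obtain ⟨V₀, hV₀⟩ := exists_isMeasurableSelection hS hR
  let T : stdSimplex ℝ Ω → Finset ι := fun x => Finset.univ.filter fun i => μ i = x
  -- Off the beliefs of positive weight, `V₀` keeps `V` a selection; only finitely many values
  -- change, so `V` stays measurable.
  let V : stdSimplex ℝ Ω → ℝ := fun x =>
    if 0 < ∑ i ∈ T x, w i then (T x).centerMass w (fun i => uS (a i)) else V₀ x
  have hT : ∀ {x i}, i ∈ T x → μ i = x := fun hi => (Finset.mem_filter.1 hi).2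
  refine ⟨V, ⟨hV₀.measurable.measurable_of_countable_ne
    ((Set.finite_range μ).countable.mono fun x hx => ?_), fun x => ?_⟩, fun f => ?_⟩
  · by_contra hx'
    have : T x = ∅ := Finset.filter_eq_empty_iff.2 fun i _ hi => hx' ⟨i, hi⟩
    exact hx (by simp [V, this])
  · by_cases hx : 0 < ∑ i ∈ T x, w i
    · simp only [V, if_pos hx]
      refine Finset.centerMass_mem_convexHull _ (fun i _ => h.nonneg i) hx fun i hi => ?_
      exact ⟨a i, hT hi ▸ h.best i, rfl⟩
    · simp only [V, if_neg hx]
      exact hV₀.mem x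
  · rw [← Finset.sum_fiberwise_of_maps_to (t := Finset.univ.image μ) (g := μ) (by simp),
      ← Finset.sum_fiberwise_of_maps_to (t := Finset.univ.image μ) (g := μ) (by simp)]
    refine Finset.sum_congr rfl fun x _ => ?_
    change ∑ i ∈ T x, _ = ∑ i ∈ T x, _
    have e1 : ∑ i ∈ T x, w i * (V (μ i) * f (μ i)) = (∑ i ∈ T x, w i) * (V x * f x) := by
      rw [Finset.sum_mul]
      exact Finset.sum_congr rfl fun i hi => by rw [hT hi]
    have e2 : ∑ i ∈ T x, w i * (uS (a i) * f (μ i)) = (∑ i ∈ T x, w i * uS (a i)) * f x := by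
      rw [Finset.sum_mul]
      exact Finset.sum_congr rfl fun i hi => by rw [hT hi, mul_assoc]
    rw [e1, e2]
    by_cases hx : 0 < ∑ i ∈ T x, w i
    · simp only [V, if_pos hx, Finset.centerMass, smul_eq_mul]
      field_simp
    · have h0 : ∑ i ∈ T x, w i = 0 :=
        le_antisymm (not_lt.1 hx) (Finset.sum_nonneg fun i _ => h.nonneg i)
      have h1 := (Finset.sum_eq_zero_iff_of_nonneg fun i _ => h.nonneg i).1 h0
      rw [h0, Finset.sum_eq_zero fun i hi => by rw [h1 i hi, zero_mul]]
      simp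

/-! ### The direct mechanism and its equilibrium -/

section Mechanism

variable [MetricSpace A] [CompactSpace A] [MeasurableSpace A] [BorelSpace A]

/-- A splitting with values `s` of the correspondence is implemented by the direct mechanism that
sends message `m` with probability `w m * μ m ω / p ω` in state `ω`. -/
theorem exists_implements (hS : Continuous uS) (hR : ∀ ω, Continuous (uR ω)) {p : stdSimplex ℝ Ω}
    (hp : ∀ ω, 0 < p ω) {M : Type*} [Fintype M] {w : M → ℝ} {μ : M → stdSimplex ℝ Ω}
    (hw : ∀ m, 0 ≤ w m) (hb : ∀ ω, ∑ m, w m * μ m ω = p ω)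
    {V : stdSimplex ℝ Ω → ℝ} (hV : ∀ m, V (μ m) ∈ valueCorr uS uR (μ m))
    (ht : ∀ ω, ∑ m, w m * (V (μ m) * (μ m ω - p ω)) = 0) :
    ∃ σ : Ω → stdSimplex ℝ M, Implements uS uR p σ V
      (∑ m, ENNReal.ofReal (w m) • Measure.dirac (μ m)) := by
  classical
  choose α hα hαbest using fun m => exists_mixed_bestResponse hS hR (hV m)
  let σ : Ω → stdSimplex ℝ M := fun ω => ⟨fun m => w m * μ m ω / p ω,
    fun m => div_nonneg (mul_nonneg (hw m) (stdSimplex.zero_le _ _)) (hp ω).le, by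
      rw [← Finset.sum_div, hb, div_self (hp ω).ne']⟩
  have hσ : ∀ ω m, σ ω m = w m * μ m ω / p ω := fun _ _ => rfl
  let ρ : Ω → stdSimplex ℝ Ω := fun ω => ⟨Pi.single ω 1, single_mem_stdSimplex ℝ ω⟩
  have hρ : ∀ ω r, ρ ω r = (Pi.single ω 1 : Ω → ℝ) r := fun _ _ => rfl
  have hjoint : ∀ ω m, jointProb p σ ρ ω m = w m * μ m ω := fun ω m => by
    have := (hp ω).ne'
    simp only [jointProb, hρ, Pi.single_apply, ite_mul, one_mul, zero_mul, Finset.sum_ite_eq',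
      Finset.mem_univ, if_true, hσ]
    field_simp
  have hmsg : ∀ m, messageProb p σ ρ m = w m := fun m => by
    simp only [messageProb, hjoint, ← Finset.mul_sum, stdSimplex.sum_eq_one, mul_one]
  -- Truth-telling at state `r`, divided by `p r`, says that the expected value after report `r`
  -- does not depend on `r`.
  have hvalue : ∀ r, ∑ m, σ r m * V (μ m) = ∑ m, w m * V (μ m) := fun r => by
    have h1 : ∑ m, w m * μ m r * V (μ m) = p r * ∑ m, w m * V (μ m) := by
      rw [Finset.mul_sum, ← sub_eq_zero, ← Finset.sum_sub_distrib, ← ht r]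
      exact Finset.sum_congr rfl fun m _ => by ring
    have := (hp r).ne'
    calc ∑ m, σ r m * V (μ m) = (∑ m, w m * μ m r * V (μ m)) / p r := by
          rw [Finset.sum_div]
          exact Finset.sum_congr rfl fun m _ => by rw [hσ]; ring
      _ = _ := by rw [h1]; field_simp
  have hsender : ∀ ρ' : Ω → stdSimplex ℝ Ω,
      gamePayoff (fun _ => uS) p σ ρ' α = ∑ m, w m * V (μ m) := fun ρ' => by
    have h1 : ∀ ω, ∑ m, jointProb p σ ρ' ω m * V (μ m) = p ω * ∑ m, w m * V (μ m) := fun ω => by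
      calc ∑ m, jointProb p σ ρ' ω m * V (μ m)
          = p ω * ∑ r, ρ' ω r * ∑ m, σ r m * V (μ m) := by
            simp only [jointProb, Finset.mul_sum, Finset.sum_mul]
            rw [Finset.sum_comm]
            exact Finset.sum_congr rfl fun r _ => Finset.sum_congr rfl fun m _ => by ring
        _ = _ := by simp only [hvalue, ← Finset.sum_mul, stdSimplex.sum_eq_one, one_mul]
    simp only [gamePayoff, hα, h1, ← Finset.sum_mul, stdSimplex.sum_eq_one, one_mul]
  have hint : ∀ (ω : Ω) (ν : ProbabilityMeasure A), Integrable (uR ω) (ν : Measure A) :=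
    fun ω ν => (hR ω).integrable_of_hasCompactSupport (HasCompactSupport.of_compactSpace _)
  have hreceiver : ∀ α' : M → ProbabilityMeasure A, gamePayoff uR p σ ρ α' =
      ∑ m, w m * ∑ ω, μ m ω * ∫ a, uR ω a ∂(α' m : Measure A) := fun α' => by
    simp only [gamePayoff, hjoint, Finset.mul_sum]
    rw [Finset.sum_comm]
    exact Finset.sum_congr rfl fun m _ => Finset.sum_congr rfl fun ω _ => mul_assoc _ _ _
  refine ⟨σ, ρ, α, μ, ⟨fun ρ' => ?_, fun α' => ?_⟩, fun m ω => ?_, ?_, fun m _ => hα m⟩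
  · rw [hsender, hsender]
  · rw [hreceiver, hreceiver]
    exact Finset.sum_le_sum fun m _ => mul_le_mul_of_nonneg_left
      (hαbest m (α' m) fun ω => hint ω _) (hw m)
  · rw [hmsg, hjoint]
  · simp only [hmsg]

end Mechanism

end Mediation

/-! ### Assembly of the main theorem -/

theorem proposition1 {Ω A : Type*} [Fintype Ω] [MetricSpace A] [CompactSpace A] [Nonempty A]
    [MeasurableSpace A] [BorelSpace A]
    (uS : A → ℝ) (hS : Continuous uS) (uR : Ω → A → ℝ) (hR : ∀ ω, Continuous (uR ω))
    (p : stdSimplex ℝ Ω) (hp : ∀ ω, 0 < p ω) :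
    (∃ (V : stdSimplex ℝ Ω → ℝ) (τ : Measure (stdSimplex ℝ Ω)),
      Mediation.IsSolution uS uR p V τ ∧
      ∃ k : ℕ, k ≤ 2 * Fintype.card Ω - 1 ∧
        ∃ σ : Ω → stdSimplex ℝ (Fin k), Mediation.Implements uS uR p σ V τ) ∧
    IsGreatest {x : ℝ | ∃ V : stdSimplex ℝ Ω → ℝ, Mediation.IsMeasurableSelection uS uR V ∧
        x = ⨅ g : Ω → ℝ, Mediation.cav (Mediation.virtualValue p V g) p}
      (Mediation.mdValue uS uR p) := by
  obtain ⟨v, hv⟩ := Mediation.exists_isGreatest_payoff hS hR p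
  have hle : ∀ (V' : stdSimplex ℝ Ω → ℝ) (τ' : Measure (stdSimplex ℝ Ω)),
      Mediation.IsFeasible uS uR p V' τ' → ∫ μ, V' μ ∂τ' ≤ v :=
    fun V' τ' h => hv.2 (h.mem_convexHull hS hR)
  obtain ⟨N, w₀, μ₀, a₀, h₀, hval₀⟩ := Mediation.exists_isSplitting hv.1
  obtain ⟨k, hk, w, μ, a, h, hval⟩ := h₀.exists_card_le
  rw [hval₀] at hval
  obtain ⟨V, hV, hVf⟩ := h.exists_selection hS hR
  have htruth : ∀ ω, ∑ i, w i * (V (μ i) * (μ i ω - p ω)) = 0 := fun ω => by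
    rw [hVf fun x => x ω - p ω, h.truth]
  have hpay : v ≤ ∑ i, w i * V (μ i) := by
    have := hVf fun _ => 1
    simp only [mul_one] at this
    rwa [this]
  set τ : Measure (stdSimplex ℝ Ω) := ∑ i, ENNReal.ofReal (w i) • Measure.dirac (μ i) with hτ
  have hint : ∀ f : stdSimplex ℝ Ω → ℝ, Measurable f → ∫ x, f x ∂τ = ∑ i, w i * f (μ i) :=
    fun f hf => Mediation.integral_sum_smul_dirac h.nonneg μ hf.stronglyMeasurable
  have hmeas : ∀ ω, Measurable fun x : stdSimplex ℝ Ω => x ω :=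
    fun ω => (Mediation.continuous_belief_apply ω).measurable
  have hfeas : Mediation.IsFeasible uS uR p V τ :=
    { selection := hV
      isProbability := Mediation.isProbabilityMeasure_sum_smul_dirac h.nonneg h.sum_weights μ
      bayesPlausible := fun ω => by rw [hint _ (hmeas ω), h.bayes]
      truthTelling := fun ω => by
        rw [hint (fun x => V x * (x ω - p ω)) (hV.measurable.mul ((hmeas ω).sub_const _)),
          htruth] }
  have hVv : ∫ x, V x ∂τ = v :=
    le_antisymm (hle V τ hfeas) (by rwa [hint V hV.measurable])
  have hmd : Mediation.mdValue uS uR p = v := by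
    refine IsGreatest.csSup_eq ⟨⟨V, τ, hfeas, hVv.symm⟩, ?_⟩
    rintro _ ⟨V', τ', h', rfl⟩
    exact hle V' τ' h'
  refine ⟨⟨V, τ, ⟨hfeas, fun V' τ' h' => (hle V' τ' h').trans_eq hVv.symm⟩, k, hk,
    Mediation.exists_implements hS hR hp h.nonneg h.bayes (fun m => hV.mem _) htruth⟩, ?_⟩
  rw [hmd]
  -- The `V` that solves the mediation problem also attains the maximum in the dual formula.
  refine ⟨⟨V, hV, le_antisymm (le_ciInf fun g => ?_) (Mediation.iInf_cav_le hS hR hv hV)⟩, ?_⟩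
  · obtain ⟨C, hC⟩ := Mediation.exists_abs_le_of_mem_valueCorr hS uR
    refine le_trans ?_ (Mediation.sum_le_cav (Mediation.virtualValue_le
      (fun x => hC x _ (hV.mem x)) g) h.nonneg h.sum_weights h.bayes)
    refine hpay.trans_eq ?_
    -- The `g`-term is a combination of the truth-telling sums, which vanish.
    have h1 : ∑ i, w i * Mediation.virtualValue p V g (μ i) = ∑ i, w i * V (μ i) +
        ∑ ω, g ω * ∑ i, w i * (V (μ i) * (μ i ω - p ω)) := by
      simp only [Finset.mul_sum]
      rw [Finset.sum_comm, ← Finset.sum_add_distrib]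
      refine Finset.sum_congr rfl fun i _ => ?_
      rw [Mediation.virtualValue, add_mul, one_mul, mul_add, Finset.sum_mul, Finset.mul_sum]
      congr 1
      exact Finset.sum_congr rfl fun ω _ => by ring
    rw [h1]
    simp [htruth]
  · rintro _ ⟨V', hV', rfl⟩
    exact Mediation.iInf_cav_le hS hR hv hV'
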